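/- Let $n\ge 1$ and $k\ge 0$ be integers, and write $[n]=\{1,\dots,n\}$. A tuple $\alpha=(a_1,\dots,a_n)\in[n]^n$ is a \emph{Fubini ranking} if it records a valid ranking of $n$ competitors with ties allowed, that is, $a_i=1+|\{j: a_j<a_i\}|$ for all $i$ (if $m$ competitors tie at rank $r$, the ranks $r+1,\dots,r+m-1$ are not used). Its \emph{ranks} are its distinct values. Regard $\alpha$ also as the parking preferences of cars $1,\dots,n$, which arrive in this order on a one-way street with spots $1,\dots,n$: car $i$ parks in the first unoccupied spot among $a_i,a_i+1,\dots,n$, if there is one. The tuple $\alpha$ is a \emph{unit interval parking function} if every car is able to park and each car $i$ parks in spot $a_i$ or $a_i+1$. Its \emph{outcome} is then the permutation $\pi=\pi_1\cdots\pi_n\in\mathfrak S_n$, in one-line notation, for which $\pi_j$ is the car parked in spot $j$. A \emph{unit Fubini ranking} of length $n$ is a Fubini ranking that is also a unit interval parking function. Let $s_i=(i,i+1)$ for $1\le i\le n-1$. The right weak order $W(\mathfrak S_n)$ is the partial order on $\mathfrak S_n$ whose cover relations are $\tau\lessdot\sigma$ if and only if $\sigma=\tau s_i$ for some $i$ with $\sigma_i>\sigma_{i+1}$.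 A \emph{Boolean interval of rank $k$} is an interval $[\sigma,\tau]$, $\sigma\le\tau$, of $W(\mathfrak S_n)$ that is isomorphic, as a poset, to the poset of all subsets of a $k$-element set ordered by inclusion. \textbf{Theorem.} The map $$\alpha\longmapsto\Bigl[\pi,\ \pi\prod_{i\in I}s_i\Bigr],$$ where $\pi$ is the outcome of $\alpha$ and $I$ is the set of values that occur more than once in $\alpha$ (the transpositions $s_i$, $i\in I$, commute pairwise), is a bijection from the set of unit Fubini rankings of length $n$ with exactly $n-k$ distinct ranks onto the set of Boolean intervals of rank $k$ in $W(\mathfrak S_n)$. -/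

import Mathlib

/-!
The set `[n] = {1, …, n}` is modelled by `Fin n = {0, …, n - 1}`: the number `i + 1` of `[n]`
corresponds to `i : Fin n`.  This applies to competitors, ranks, cars, parking spots, and the
positions and values of a permutation.  Similarly `[n - 1]` is modelled by `Fin (n - 1)`.
-/

namespace UnitFubini

variable {n : ℕ}

/-! ### The right weak order on the symmetric group -/

/-- The element `i` of `[n - 1]`, viewed in `[n]`. -/
def lo (i : Fin (n - 1)) : Fin n := ⟨i, by omega⟩

/-- The element `i + 1` of `[n]`, for `i` in `[n - 1]`. -/
def hi (i : Fin (n - 1)) : Fin n := ⟨i + 1, by omega⟩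

/-- The simple transposition `s_i = (i, i + 1)`. -/
def simple (i : Fin (n - 1)) : Equiv.Perm (Fin n) := Equiv.swap (lo i) (hi i)

/-- `i` is a descent of `σ` (in one-line notation `σ = σ 0, σ 1, …`). -/
def IsDescent (σ : Equiv.Perm (Fin n)) (i : Fin (n - 1)) : Prop := σ (hi i) < σ (lo i)

/-- The cover relation of the right weak order: `τ s_i = σ` for some descent `i` of `σ`. -/
def WeakCover (τ σ : Equiv.Perm (Fin n)) : Prop := ∃ i, IsDescent σ i ∧ τ * simple i = σ

theorem WeakCover.toLex_lt {τ σ : Equiv.Perm (Fin n)} (h : WeakCover τ σ) :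
    toLex (⇑τ) < toLex (⇑σ) := by
  obtain ⟨i, hd, rfl⟩ := h
  refine ⟨lo i, fun j hj => ?_, ?_⟩
  · have h1 : j ≠ lo i := ne_of_lt hj
    have h2 : j ≠ hi i := by
      have : lo i < hi i := by simp [lo, hi]
      exact ne_of_lt (hj.trans this)
    simp [simple, Equiv.swap_apply_of_ne_of_ne h1 h2]
  · simpa [IsDescent, simple] using hd

theorem toLex_le_of_reflTransGen {τ σ : Equiv.Perm (Fin n)}
    (h : Relation.ReflTransGen WeakCover τ σ) : toLex (⇑τ) ≤ toLex (⇑σ) := by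
  induction h with
  | refl => exact le_rfl
  | tail _ hc ih => exact ih.trans hc.toLex_lt.le

/-- The symmetric group on `[n]`, to be ordered by the right weak order. -/
def WeakOrder (n : ℕ) : Type := Equiv.Perm (Fin n)

/-- A permutation as an element of the weak order. -/
def toWeak (σ : Equiv.Perm (Fin n)) : WeakOrder n := σ

/-- The right weak order: the reflexive transitive closure of its cover relation. -/
instance : PartialOrder (WeakOrder n) where
  le τ σ := Relation.ReflTransGen (WeakCover (n := n)) τ σ
  le_refl _ := Relation.ReflTransGen.refl
  le_trans _ _ _ := Relation.ReflTransGen.trans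
  le_antisymm _ _ h₁ h₂ := DFunLike.coe_injective (F := Equiv.Perm (Fin n)) <|
    toLex.injective <| le_antisymm (toLex_le_of_reflTransGen h₁) (toLex_le_of_reflTransGen h₂)

/-- `B` is an interval `[σ, τ]` with `σ ≤ τ` of the right weak order which, as a poset, is
isomorphic to the poset of all subsets of a `k`-element set, ordered by inclusion. -/
def IsBooleanInterval (k : ℕ) (B : Set (WeakOrder n)) : Prop :=
  (∃ σ τ : WeakOrder n, σ ≤ τ ∧ B = Set.Icc σ τ) ∧ Nonempty (B ≃o Finset (Fin k))

/-! ### Parking -/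

/-- Given preferences `α`, the cars `0, 1, …` arrive one at a time, and car `i` parks in spot
`s i`: the first spot, from its preferred spot `α i` on, that no earlier car occupies. -/
def Parks (α s : Fin n → Fin n) : Prop :=
  ∀ i, IsLeast {t | α i ≤ t ∧ ∀ j < i, s j ≠ t} (s i)

/-- All cars are able to park. -/
def IsParkingFunction (α : Fin n → Fin n) : Prop := ∃ s, Parks α s

/-- Every car parks in its preferred spot or in the spot right after it. -/
def IsUnitIntervalParkingFunction (α : Fin n → Fin n) : Prop :=
  ∃ s, Parks α s ∧ ∀ i, (s i : ℕ) = α i ∨ (s i : ℕ) = α i + 1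

theorem IsUnitIntervalParkingFunction.isParkingFunction {α : Fin n → Fin n}
    (h : IsUnitIntervalParkingFunction α) : IsParkingFunction α :=
  h.imp fun _ hs => hs.1

theorem Parks.injective {α s : Fin n → Fin n} (h : Parks α s) : Function.Injective s := by
  intro i j hij
  rcases lt_trichotomy i j with hlt | heq | hlt
  · exact absurd hij ((h j).1.2 i hlt)
  · exact heq
  · exact absurd hij.symm ((h i).1.2 j hlt)

/-- The spots in which the cars park are determined by the preferences. -/
theorem Parks.unique {α s t : Fin n → Fin n} (hs : Parks α s) (ht : Parks α t) : s = t := by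
  funext i
  induction i using WellFoundedLT.induction with
  | ind i ih =>
    have e : {u | α i ≤ u ∧ ∀ j < i, s j ≠ u} = {u | α i ≤ u ∧ ∀ j < i, t j ≠ u} := by
      ext u
      exact and_congr_right fun _ => forall₂_congr fun j hj => by rw [ih j hj]
    exact (hs i).unique (e ▸ ht i)

/-- The outcome of a parking function, in one-line notation: its entry at spot `j` is the car
that parks in spot `j`. -/
noncomputable def outcome (α : Fin n → Fin n) (h : IsParkingFunction α) : Equiv.Perm (Fin n) :=
  (Equiv.ofBijective h.choose
    (Finite.injective_iff_bijective.mp h.choose_spec.injective)).symm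

/-! ### Fubini rankings -/

/-- `α` records a valid ranking of `n` competitors with ties allowed: the rank of a competitor
is one more than the number of competitors ranked strictly better (with the shift by one, it is
that number).  So if `m` competitors tie at rank `r`, the next available rank is `r + m`. -/
def IsFubiniRanking (α : Fin n → Fin n) : Prop :=
  ∀ i, (α i : ℕ) = (Finset.univ.filter fun j => α j < α i).card

/-- The number of distinct ranks. -/
def numRanks (α : Fin n → Fin n) : ℕ := (Finset.univ.image α).card

/-- The set of repeated values of `α`, as a subset of `[n - 1]`.  (In a Fubini ranking, the
value `n` cannot be repeated.) -/
def repeated (α : Fin n → Fin n) : Finset (Fin (n - 1)) :=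
  Finset.univ.filter fun i => ∃ j₁ j₂, j₁ ≠ j₂ ∧ α j₁ = lo i ∧ α j₂ = lo i

/-- In a Fubini ranking, a value just above a repeated value does not occur. -/
theorem IsFubiniRanking.ne_hi {α : Fin n → Fin n} (h : IsFubiniRanking α) {i : Fin (n - 1)}
    (hi' : i ∈ repeated α) (j : Fin n) : α j ≠ hi i := by
  intro hj
  obtain ⟨j₁, j₂, hne, h₁, h₂⟩ : ∃ j₁ j₂, j₁ ≠ j₂ ∧ α j₁ = lo i ∧ α j₂ = lo i := by
    simpa [repeated] using hi'
  have e₁ := h j₁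
  have e := h j
  rw [h₁] at e₁
  rw [hj] at e
  have hlt : lo i < hi i := by simp [lo, hi]
  have hsub : insert j₁ (insert j₂ (Finset.univ.filter fun j => α j < lo i)) ⊆
      Finset.univ.filter fun j => α j < hi i := by
    intro x hx
    simp only [Finset.mem_insert, Finset.mem_filter, Finset.mem_univ, true_and] at hx ⊢
    rcases hx with rfl | rfl | hx
    · rwa [h₁]
    · rwa [h₂]
    · exact hx.trans hlt
  have hc := Finset.card_le_card hsub
  rw [Finset.card_insert_of_notMem (by simp [hne, h₁]),
    Finset.card_insert_of_notMem (by simp [h₂]), ← e₁, ← e] at hc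
  simp [lo, hi] at hc

theorem simple_commute {i j : Fin (n - 1)} (h₁ : (i : ℕ) ≠ j + 1) (h₂ : (j : ℕ) ≠ i + 1) :
    Commute (simple i) (simple j) := by
  by_cases hij : i = j
  · rw [hij]
  · have hij' : (i : ℕ) ≠ j := fun h => hij (Fin.ext h)
    apply Equiv.Perm.Disjoint.commute
    intro x
    by_cases hx : x = lo i ∨ x = hi i
    · right
      apply Equiv.swap_apply_of_ne_of_ne <;>
        rcases hx with rfl | rfl <;> simp [lo, hi, Fin.ext_iff] <;> omega
    · left
      push Not at hx
      exact Equiv.swap_apply_of_ne_of_ne hx.1 hx.2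

/-- The transpositions `s_i`, for `i` a repeated value of a Fubini ranking, commute. -/
theorem IsFubiniRanking.commute {α : Fin n → Fin n} (h : IsFubiniRanking α) :
    (repeated α : Set (Fin (n - 1))).Pairwise (Function.onFun Commute simple) := by
  have key : ∀ i ∈ repeated α, ∀ j ∈ repeated α, (j : ℕ) ≠ i + 1 := by
    intro i hi' j hj hji
    obtain ⟨j₁, -, -, h₁, -⟩ : ∃ j₁ j₂, j₁ ≠ j₂ ∧ α j₁ = lo j ∧ α j₂ = lo j := by
      simpa [repeated] using hj
    exact h.ne_hi hi' j₁ (h₁.trans (Fin.ext (by simpa [lo, hi] using hji)))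
  intro i hi' j hj _
  exact simple_commute (key j hj i hi') (key i hi' j hj)

/-- Unit Fubini rankings of length `n`: the Fubini rankings that are unit interval parking
functions. -/
def UFR (n : ℕ) : Type :=
  {α : Fin n → Fin n // IsFubiniRanking α ∧ IsUnitIntervalParkingFunction α}

/-- The parking outcome `π` of a unit Fubini ranking. -/
noncomputable def UFR.outcome (α : UFR n) : Equiv.Perm (Fin n) :=
  UnitFubini.outcome α.1 α.2.2.isParkingFunction

/-- The product of the commuting transpositions `s_i` over the repeated values `i`. -/
def UFR.prodSimple (α : UFR n) : Equiv.Perm (Fin n) :=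
  (repeated α.1).noncommProd simple α.2.1.commute

/-- The interval `[π, π ∏_{i ∈ I} s_i]` of the right weak order, where `π` is the outcome of `α`
and `I` is its set of repeated values. -/
noncomputable def UFR.interval (α : UFR n) : Set (WeakOrder n) :=
  Set.Icc (toWeak α.outcome) (toWeak (α.outcome * α.prodSimple))

end UnitFubini

/-! Both sides are encoded by pairs (π, I), where I is a set of pairwise nonadjacent ascents of π
(`AscentSet`).

Rankings: two cars tied at rank i fill spots i and i + 1 in order of arrival, so i is an ascent of
the outcome. Conversely, the Fubini condition forces a displaced car to share its preference with
the car that displaced it. So (π, I) determines the ranking (`UFR.eq_ranking`), and every such pair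
occurs (`AscentSet.exists_ufr`). The ranks not used are the i + 1 with i ∈ I, so there are n - |I|
ranks.

Intervals: inversions persist upwards in the weak order (`inversion_of_le`). Hence everything
between π and π ∏ s_i is π times a subproduct, and subproducts compare by inclusion
(`AscentSet.isBooleanInterval`). Conversely, an identity s_i s_p = s_j s_q read off each square of a
Boolean interval makes opposite edges carry the same simple transposition, and edges at a common
vertex carry commuting ones. So the interval is spanned by its atoms
(`exists_ascents_of_orderEmbedding`). -/

namespace UnitFubini

variable {n : ℕ}

/-! ### Products of simple transpositions at pairwise nonadjacent positions -/

/-- No two elements of `J` are consecutive. -/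
def NonAdj (J : Finset (Fin (n - 1))) : Prop := ∀ i ∈ J, ∀ j ∈ J, (j : ℕ) ≠ i + 1

theorem NonAdj.mono {J K : Finset (Fin (n - 1))} (h : NonAdj K) (hJK : J ⊆ K) : NonAdj J :=
  fun i hi j hj => h i (hJK hi) j (hJK hj)

theorem NonAdj.commute {J : Finset (Fin (n - 1))} (h : NonAdj J) :
    (J : Set (Fin (n - 1))).Pairwise (Function.onFun Commute simple) :=
  fun i hi j hj _ => simple_commute (h j hj i hi) (h i hi j hj)

open Classical in
/-- The product of the commuting transpositions `s_i` over a set `J` without consecutive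
elements, and `1` for other sets `J`. -/
noncomputable def swaps (J : Finset (Fin (n - 1))) : Equiv.Perm (Fin n) :=
  if h : NonAdj J then J.noncommProd simple h.commute else 1

@[simp] theorem hi_inj {i j : Fin (n - 1)} : hi i = hi j ↔ i = j := by
  simp [hi, Fin.ext_iff]

@[simp] theorem val_lo (i : Fin (n - 1)) : (lo i : ℕ) = i := rfl

@[simp] theorem val_hi (i : Fin (n - 1)) : (hi i : ℕ) = i + 1 := rfl

theorem lo_lt_hi (i : Fin (n - 1)) : lo i < hi i := by simp [Fin.lt_def]

@[simp] theorem simple_lo (i : Fin (n - 1)) : simple i (lo i) = hi i := Equiv.swap_apply_left _ _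

@[simp] theorem simple_hi (i : Fin (n - 1)) : simple i (hi i) = lo i := Equiv.swap_apply_right _ _

theorem simple_of_ne {i : Fin (n - 1)} {x : Fin n} (h₁ : x ≠ lo i) (h₂ : x ≠ hi i) :
    simple i x = x := Equiv.swap_apply_of_ne_of_ne h₁ h₂

@[simp] theorem simple_mul_self (i : Fin (n - 1)) : simple i * simple i = 1 :=
  Equiv.swap_mul_self _ _

theorem val_simple (i : Fin (n - 1)) (x : Fin n) :
    (simple i x : ℕ) = if (x : ℕ) = i then (i : ℕ) + 1 else if (x : ℕ) = i + 1 then i else x := by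
  rw [simple, Equiv.swap_apply_def]
  simp only [Fin.ext_iff, val_lo, val_hi]
  split_ifs <;> simp

@[simp] theorem swaps_empty : swaps (∅ : Finset (Fin (n - 1))) = 1 := by
  rw [swaps, dif_pos (by simp [NonAdj]), Finset.noncommProd_empty]

theorem swaps_insert {J : Finset (Fin (n - 1))} {i : Fin (n - 1)} (hJ : NonAdj (insert i J))
    (hi : i ∉ J) : swaps (insert i J) = swaps J * simple i := by
  rw [swaps, swaps, dif_pos hJ, dif_pos (hJ.mono (Finset.subset_insert i J)),
    Finset.noncommProd_insert_of_notMem' _ _ _ _ hi]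

theorem swaps_of_ne {J : Finset (Fin (n - 1))} {x : Fin n}
    (hx : ∀ i ∈ J, x ≠ lo i ∧ x ≠ hi i) : swaps J x = x := by
  by_cases hJ : NonAdj J
  · rw [swaps, dif_pos hJ]
    refine Finset.noncommProd_induction J simple hJ.commute (fun σ => σ x = x) ?_ rfl ?_
    · intro a b ha hb
      rw [Equiv.Perm.mul_apply, hb, ha]
    · exact fun i hi => simple_of_ne (hx i hi).1 (hx i hi).2
  · rw [swaps, dif_neg hJ, Equiv.Perm.one_apply]

theorem swaps_eq_erase_mul {J : Finset (Fin (n - 1))} (hJ : NonAdj J) {i : Fin (n - 1)}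
    (hi : i ∈ J) : swaps J = swaps (J.erase i) * simple i := by
  conv_lhs => rw [← Finset.insert_erase hi]
  exact swaps_insert (by rwa [Finset.insert_erase hi]) (Finset.notMem_erase i J)

theorem swaps_lo {J : Finset (Fin (n - 1))} (hJ : NonAdj J) {i : Fin (n - 1)} (hi' : i ∈ J) :
    swaps J (lo i) = hi i := by
  rw [swaps_eq_erase_mul hJ hi', Equiv.Perm.mul_apply, simple_lo]
  refine swaps_of_ne fun j hj => ?_
  have h₁ := hJ i hi' j (Finset.mem_of_mem_erase hj)
  have h₂ : (j : ℕ) ≠ i := fun h => Finset.ne_of_mem_erase hj (Fin.ext h)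
  constructor <;> simp only [ne_eq, Fin.ext_iff, val_lo, val_hi] <;> omega

theorem swaps_hi {J : Finset (Fin (n - 1))} (hJ : NonAdj J) {i : Fin (n - 1)} (hi' : i ∈ J) :
    swaps J (hi i) = lo i := by
  rw [swaps_eq_erase_mul hJ hi', Equiv.Perm.mul_apply, simple_hi]
  refine swaps_of_ne fun j hj => ?_
  have h₁ := hJ j (Finset.mem_of_mem_erase hj) i hi'
  have h₂ : (j : ℕ) ≠ i := fun h => Finset.ne_of_mem_erase hj (Fin.ext h)
  constructor <;> simp only [ne_eq, Fin.ext_iff, val_lo, val_hi] <;> omega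

theorem swaps_cases {J : Finset (Fin (n - 1))} (hJ : NonAdj J) (x : Fin n) :
    ((∀ i ∈ J, x ≠ lo i ∧ x ≠ hi i) ∧ swaps J x = x) ∨ (∃ i ∈ J, x = lo i ∧ swaps J x = hi i) ∨
      ∃ i ∈ J, x = hi i ∧ swaps J x = lo i := by
  by_cases h₁ : ∃ i ∈ J, x = lo i
  · obtain ⟨i, hi', rfl⟩ := h₁
    exact Or.inr (Or.inl ⟨i, hi', rfl, swaps_lo hJ hi'⟩)
  by_cases h₂ : ∃ i ∈ J, x = hi i
  · obtain ⟨i, hi', rfl⟩ := h₂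
    exact Or.inr (Or.inr ⟨i, hi', rfl, swaps_hi hJ hi'⟩)
  have h : ∀ i ∈ J, x ≠ lo i ∧ x ≠ hi i :=
    fun i hi' => ⟨fun h => h₁ ⟨i, hi', h⟩, fun h => h₂ ⟨i, hi', h⟩⟩
  exact Or.inl ⟨h, swaps_of_ne h⟩

/-- Position j moves up only if j ∈ J, and position j + 1 moves down only if j ∈ J. -/
theorem swaps_lo_lt_swaps_hi {J : Finset (Fin (n - 1))} (hJ : NonAdj J) {j : Fin (n - 1)}
    (hj : j ∉ J) : swaps J (lo j) < swaps J (hi j) := by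
  have hne : ∀ i ∈ J, (i : ℕ) ≠ j := fun i hi' h => hj (Fin.ext h ▸ hi')
  rcases swaps_cases hJ (lo j) with ⟨-, e⟩ | ⟨i, hi', h, e⟩ | ⟨i, hi', h, e⟩ <;>
  rcases swaps_cases hJ (hi j) with ⟨-, e'⟩ | ⟨i', hi'', h', e'⟩ | ⟨i', hi'', h', e'⟩ <;>
  (rw [e, e']
   simp only [Fin.lt_def, Fin.ext_iff, val_lo, val_hi] at *
   try have := hne _ hi'
   try have := hne _ hi''
   omega)

/-- The descent set of the product is J, so J can be recovered from `swaps J`. -/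
theorem mem_iff_swaps_hi_lt {J : Finset (Fin (n - 1))} (hJ : NonAdj J) {j : Fin (n - 1)} :
    j ∈ J ↔ swaps J (hi j) < swaps J (lo j) := by
  refine ⟨fun hj => ?_, fun h => ?_⟩
  · rw [swaps_lo hJ hj, swaps_hi hJ hj]
    exact lo_lt_hi j
  · by_contra hj
    exact h.not_gt (swaps_lo_lt_swaps_hi hJ hj)

/-- If a product of two distinct simple transpositions is also a product with another first factor
`s_j`, then the two factors commute and are exchanged. -/
theorem simple_mul_simple_eq {i j a b : Fin (n - 1)} (h : simple i * simple a = simple j * simple b)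
    (hij : i ≠ j) (hia : i ≠ a) : b = i ∧ (j : ℕ) ≠ i + 1 ∧ (i : ℕ) ≠ j + 1 := by
  have key : ∀ x : Fin n, (simple i (simple a x) : ℕ) = simple j (simple b x) := fun x => by
    rw [← Equiv.Perm.mul_apply, h, Equiv.Perm.mul_apply]
  have val : ∀ (c : Fin (n - 1)) (x : Fin n), ((x : ℕ) = c ∧ (simple c x : ℕ) = c + 1) ∨
      ((x : ℕ) = c + 1 ∧ (simple c x : ℕ) = c) ∨
      ((x : ℕ) ≠ c ∧ (x : ℕ) ≠ c + 1 ∧ (simple c x : ℕ) = x) := fun c x => by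
    rw [val_simple]
    split_ifs <;> omega
  have hij' : (i : ℕ) ≠ j := fun h => hij (Fin.ext h)
  have hia' : (i : ℕ) ≠ a := fun h => hia (Fin.ext h)
  -- Both products are turned into case distinctions on natural numbers; their values at the
  -- endpoints of a, b and i decide the claim.
  have point : ∀ x : Fin n, ∃ y z : ℕ,
      (((x : ℕ) = a ∧ y = a + 1) ∨ ((x : ℕ) = a + 1 ∧ y = a) ∨
        ((x : ℕ) ≠ a ∧ (x : ℕ) ≠ a + 1 ∧ y = x)) ∧
      (((x : ℕ) = b ∧ z = b + 1) ∨ ((x : ℕ) = b + 1 ∧ z = b) ∨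
        ((x : ℕ) ≠ b ∧ (x : ℕ) ≠ b + 1 ∧ z = x)) ∧
      ∃ w : ℕ, ((y = i ∧ w = i + 1) ∨ (y = i + 1 ∧ w = i) ∨ (y ≠ i ∧ y ≠ i + 1 ∧ w = y)) ∧
        ((z = j ∧ w = j + 1) ∨ (z = j + 1 ∧ w = j) ∨ (z ≠ j ∧ z ≠ j + 1 ∧ w = z)) :=
    fun x => ⟨simple a x, simple b x, val a x, val b x, simple i (simple a x), val i _,
      key x ▸ val j _⟩
  obtain ⟨y₁, z₁, h₁, h₁', w₁, h₁'', h₁'''⟩ := point (lo a)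
  obtain ⟨y₂, z₂, h₂, h₂', w₂, h₂'', h₂'''⟩ := point (hi a)
  obtain ⟨y₃, z₃, h₃, h₃', w₃, h₃'', h₃'''⟩ := point (lo b)
  obtain ⟨y₄, z₄, h₄, h₄', w₄, h₄'', h₄'''⟩ := point (hi b)
  obtain ⟨y₅, z₅, h₅, h₅', w₅, h₅'', h₅'''⟩ := point (lo i)
  obtain ⟨y₆, z₆, h₆, h₆', w₆, h₆'', h₆'''⟩ := point (hi i)
  simp only [val_lo, val_hi] at *
  rw [Fin.ext_iff]
  clear key h hij hia val point
  generalize (i : ℕ) = i at *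
  generalize (j : ℕ) = j at *
  generalize (a : ℕ) = a at *
  generalize (b : ℕ) = b at *
  grind (splits := 40)

/-! ### Inversions and covers in the weak order -/

/-- Right multiplication by s_i changes the relative order only of the two values in positions i and
i + 1, and an upward step leaves these inverted. -/
theorem WeakCover.inversion {ρ ρ' : Equiv.Perm (Fin n)} (h : WeakCover ρ ρ') {a b : Fin n}
    (hab : a < b) (hinv : ρ.symm b < ρ.symm a) : ρ'.symm b < ρ'.symm a := by
  obtain ⟨i, hd, rfl⟩ := h
  have e : ∀ x, (ρ * simple i).symm x = simple i (ρ.symm x) := fun x => by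
    rw [Equiv.symm_apply_eq, ← Equiv.Perm.mul_apply, mul_assoc, simple_mul_self]
    simp
  rw [e, e]
  simp only [IsDescent, Equiv.Perm.mul_apply, simple_lo, simple_hi] at hd
  have hne : ¬ (ρ.symm b = lo i ∧ ρ.symm a = hi i) := by
    rintro ⟨h₁, h₂⟩
    rw [← h₁, ← h₂, Equiv.apply_symm_apply, Equiv.apply_symm_apply] at hd
    exact hd.not_gt hab
  simp only [Fin.lt_def, Fin.ext_iff, val_simple, val_lo, val_hi] at hinv hne ⊢
  split_ifs <;> omega

/-- Going up in the weak order preserves inversions. -/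
theorem inversion_of_le {ρ ρ' : Equiv.Perm (Fin n)} (h : toWeak ρ ≤ toWeak ρ') {a b : Fin n}
    (hab : a < b) (hinv : ρ.symm b < ρ.symm a) : ρ'.symm b < ρ'.symm a := by
  change Relation.ReflTransGen WeakCover ρ ρ' at h
  induction h with
  | refl => exact hinv
  | tail _ hc ih => exact hc.inversion hab ih

theorem WeakCover.le {ρ ρ' : Equiv.Perm (Fin n)} (h : WeakCover ρ ρ') : toWeak ρ ≤ toWeak ρ' :=
  Relation.ReflTransGen.single h

/-- The first step of a chain from ρ to ρ' is strict, so it already reaches ρ'. -/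
theorem weakCover_of_covBy {ρ ρ' : Equiv.Perm (Fin n)} (h : toWeak ρ ⋖ toWeak ρ') :
    WeakCover ρ ρ' := by
  have hle : Relation.ReflTransGen WeakCover ρ ρ' := h.le
  rcases hle.cases_head with heq | ⟨c, hc, hcρ'⟩
  · exact absurd (congrArg toWeak heq) h.ne
  · have hlt : toWeak ρ < toWeak c := by
      refine lt_of_le_of_ne hc.le fun e => hc.toLex_lt.ne ?_
      rw [show ρ = c from e]
    rcases (show toWeak c ≤ toWeak ρ' from hcρ').lt_or_eq with hlt' | heq
    · exact absurd hlt' (h.2 hlt)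
    · rwa [show c = ρ' from heq] at hc

/-! ### The interval above a permutation spanned by nonadjacent ascents -/

/-- `J` is a set of pairwise nonadjacent ascents of `π`. -/
structure AscentSet (π : Equiv.Perm (Fin n)) (J : Finset (Fin (n - 1))) : Prop where
  nonAdj : NonAdj J
  ascent : ∀ i ∈ J, π (lo i) < π (hi i)

theorem AscentSet.mono {π : Equiv.Perm (Fin n)} {J K : Finset (Fin (n - 1))} (h : AscentSet π K)
    (hJK : J ⊆ K) : AscentSet π J :=
  ⟨h.nonAdj.mono hJK, fun i hi' => h.ascent i (hJK hi')⟩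

theorem AscentSet.weakCover_insert {π : Equiv.Perm (Fin n)} {J : Finset (Fin (n - 1))}
    {i : Fin (n - 1)} (h : AscentSet π (insert i J)) (hi' : i ∉ J) :
    WeakCover (π * swaps J) (π * swaps (insert i J)) := by
  refine ⟨i, ?_, by rw [swaps_insert h.nonAdj hi', mul_assoc]⟩
  rw [IsDescent, Equiv.Perm.mul_apply, Equiv.Perm.mul_apply,
    swaps_lo h.nonAdj (Finset.mem_insert_self i J), swaps_hi h.nonAdj (Finset.mem_insert_self i J)]
  exact h.ascent i (Finset.mem_insert_self i J)

theorem AscentSet.le_union {π : Equiv.Perm (Fin n)} (J D : Finset (Fin (n - 1)))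
    (h : AscentSet π (J ∪ D)) : toWeak (π * swaps J) ≤ toWeak (π * swaps (J ∪ D)) := by
  induction D using Finset.induction_on with
  | empty => rw [Finset.union_empty]
  | insert a D _ ih =>
    rw [Finset.union_insert] at h ⊢
    have ih' := ih (h.mono (Finset.subset_insert _ _))
    by_cases ha : a ∈ J ∪ D
    · rwa [Finset.insert_eq_of_mem ha]
    · exact ih'.trans (h.weakCover_insert ha).le

/-- For i ∈ J the values π(i) < π(i + 1) are inverted in the smaller permutation, hence in the
larger one, which forces i ∈ K. -/
theorem AscentSet.swaps_le_swaps {π : Equiv.Perm (Fin n)} {I J K : Finset (Fin (n - 1))}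
    (h : AscentSet π I) (hJ : J ⊆ I) (hK : K ⊆ I) :
    toWeak (π * swaps J) ≤ toWeak (π * swaps K) ↔ J ⊆ K := by
  refine ⟨fun hle i hi' => ?_, fun hJK => ?_⟩
  · have hJ' := (h.mono hJ).nonAdj
    have hK' := (h.mono hK).nonAdj
    have inv : ∀ {L : Finset (Fin (n - 1))} (x : Fin n), NonAdj L →
        (π * swaps L).symm (π x) = swaps L x := fun {L} x hL => by
      rw [Equiv.symm_apply_eq, Equiv.Perm.mul_apply]
      congr 1
      rcases swaps_cases hL x with ⟨-, e⟩ | ⟨i, hi', rfl, e⟩ | ⟨i, hi', rfl, e⟩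
      · rw [e, e]
      · rw [e, swaps_hi hL hi']
      · rw [e, swaps_lo hL hi']
    have := inversion_of_le hle (h.ascent i (hJ hi'))
    rw [inv _ hJ', inv _ hJ', inv _ hK', inv _ hK'] at this
    exact (mem_iff_swaps_hi_lt hK').2 (this ((mem_iff_swaps_hi_lt hJ').1 hi'))
  · have := AscentSet.le_union (π := π) J K (by rw [Finset.union_eq_right.2 hJK]; exact h.mono hK)
    rwa [Finset.union_eq_right.2 hJK] at this

theorem AscentSet.le_swaps {π : Equiv.Perm (Fin n)} {I : Finset (Fin (n - 1))}
    (h : AscentSet π I) : toWeak π ≤ toWeak (π * swaps I) := by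
  simpa using (h.swaps_le_swaps (Finset.empty_subset I) subset_rfl).2 (Finset.empty_subset I)

/-- Induction down a chain from the top: each downward step must remove an element of J. -/
theorem AscentSet.exists_eq_of_mem_Icc {π ρ : Equiv.Perm (Fin n)} {I : Finset (Fin (n - 1))}
    (h : AscentSet π I) (h₁ : toWeak π ≤ toWeak ρ) (h₂ : toWeak ρ ≤ toWeak (π * swaps I)) :
    ∃ J ⊆ I, ρ = π * swaps J := by
  change Relation.ReflTransGen WeakCover ρ (π * swaps I) at h₂
  induction h₂ using Relation.ReflTransGen.head_induction_on with
  | refl => exact ⟨I, subset_rfl, rfl⟩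
  | @head ρ ρ' hc _ ih =>
    obtain ⟨J, hJ, rfl⟩ := ih (h₁.trans hc.le)
    have hJ' := (h.mono hJ).nonAdj
    obtain ⟨j, hd, hj⟩ := hc
    have hρ : ρ = π * swaps J * simple j := by rw [← hj, mul_assoc, simple_mul_self, mul_one]
    by_cases hjJ : j ∈ J
    · refine ⟨J.erase j, (Finset.erase_subset j J).trans hJ, ?_⟩
      rw [hρ, swaps_eq_erase_mul hJ' hjJ, mul_assoc, mul_assoc, simple_mul_self, mul_one]
    -- As j ∉ J, the descent at j is an inversion of π itself. The step down to ρ would undo it,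
    -- although π ≤ ρ.
    · exfalso
      rw [IsDescent, Equiv.Perm.mul_apply, Equiv.Perm.mul_apply] at hd
      have := inversion_of_le h₁ hd (by
        rw [Equiv.symm_apply_apply, Equiv.symm_apply_apply]
        exact swaps_lo_lt_swaps_hi hJ' hjJ)
      have e₁ : ρ.symm (π (swaps J (lo j))) = hi j := by
        rw [Equiv.symm_apply_eq, hρ, Equiv.Perm.mul_apply, simple_hi, Equiv.Perm.mul_apply]
      have e₂ : ρ.symm (π (swaps J (hi j))) = lo j := by
        rw [Equiv.symm_apply_eq, hρ, Equiv.Perm.mul_apply, simple_lo, Equiv.Perm.mul_apply]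
      rw [e₁, e₂] at this
      exact this.not_gt (lo_lt_hi j)

theorem AscentSet.isBooleanInterval {π : Equiv.Perm (Fin n)} {I : Finset (Fin (n - 1))}
    (h : AscentSet π I) :
    IsBooleanInterval I.card (Set.Icc (toWeak π) (toWeak (π * swaps I))) := by
  refine ⟨⟨_, _, h.le_swaps, rfl⟩, ?_⟩
  let c : Fin I.card ↪ Fin (n - 1) :=
    I.equivFin.symm.toEmbedding.trans (Function.Embedding.subtype _)
  have hc : ∀ S : Finset (Fin I.card), S.map c ⊆ I := by
    intro S i hi'
    obtain ⟨a, -, rfl⟩ := Finset.mem_map.1 hi'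
    exact (I.equivFin.symm a).2
  let f : Finset (Fin I.card) ↪o WeakOrder n :=
    OrderEmbedding.ofMapLEIff (fun S => toWeak (π * swaps (S.map c)))
      fun S T => (h.swaps_le_swaps (hc S) (hc T)).trans Finset.map_subset_map
  have hf : Set.range f = Set.Icc (toWeak π) (toWeak (π * swaps I)) := by
    ext ρ
    constructor
    · rintro ⟨S, rfl⟩
      exact ⟨(h.mono (hc S)).le_swaps, (h.swaps_le_swaps (hc S) subset_rfl).2 (hc S)⟩
    · rintro ⟨h₁, h₂⟩
      obtain ⟨J, hJ, e⟩ := h.exists_eq_of_mem_Icc (ρ := ρ) h₁ h₂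
      refine ⟨Finset.univ.filter fun a => c a ∈ J, ?_⟩
      change toWeak (π * swaps _) = ρ
      rw [e]
      congr 3
      ext i
      simp only [Finset.mem_map, Finset.mem_filter, Finset.mem_univ, true_and]
      constructor
      · rintro ⟨a, ha, rfl⟩
        exact ha
      · intro hi'
        have : c (I.equivFin ⟨i, hJ hi'⟩) = i := by simp [c]
        exact ⟨_, by rwa [this], this⟩
  exact ⟨(OrderIso.setCongr _ _ hf.symm).trans f.orderIso.symm⟩

/-! ### Boolean intervals are spanned by nonadjacent ascents -/

/-- In a Boolean interval, adding an element to a set is always multiplication by the same simple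
transposition. -/
theorem exists_ascents_of_orderEmbedding {k : ℕ} (f : Finset (Fin k) ↪o WeakOrder n)
    (hf : (Set.range f).OrdConnected) (g : Finset (Fin k) → Equiv.Perm (Fin n))
    (hg : ∀ S, f S = toWeak (g S)) :
    ∃ I : Finset (Fin (n - 1)), I.card = k ∧ AscentSet (g ∅) I ∧
      g Finset.univ = g ∅ * swaps I := by
  have hcov : ∀ S a, a ∉ S → WeakCover (g S) (g (insert a S)) := fun S a ha => by
    apply weakCover_of_covBy
    -- Convexity of the range makes covers of subsets covers in the whole weak order.
    rw [← hg, ← hg, hf.apply_covBy_apply_iff f]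
    exact Finset.covBy_insert ha
  have ginj : Function.Injective g := fun S T h => f.injective (by rw [hg, hg, h])
  have hatom : ∀ a, ∃ i, IsDescent (g {a}) i ∧ g ∅ * simple i = g {a} := fun a => by
    exact (by simpa using hcov ∅ a (by simp) : WeakCover (g ∅) (g {a}))
  choose c hc₁ hc₂ using hatom
  -- The two paths from `g T` to `g (T ∪ {a, b})` give s_{c a} s_p = s_{c b} s_q. Here p ≠ c a,
  -- since otherwise the path through a would return to `g T`.
  have diamond : ∀ (T : Finset (Fin k)) (a b : Fin k), a ∉ T → b ∉ T → a ≠ b →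
      g (insert a T) = g T * simple (c a) → g (insert b T) = g T * simple (c b) →
      g (insert a (insert b T)) = g (insert b T) * simple (c a) ∧
        c a ≠ c b ∧ (c b : ℕ) ≠ c a + 1 := by
    intro T a b ha hb hab h₁ h₂
    obtain ⟨p, -, hp⟩ := hcov (insert a T) b (by simp [hb, hab.symm])
    obtain ⟨q, -, hq⟩ := hcov (insert b T) a (by simp [ha, hab])
    have hne : c a ≠ c b := fun e => by
      rw [e, ← h₂] at h₁
      have : a ∈ insert b T := ginj h₁ ▸ Finset.mem_insert_self a T
      simp [ha, hab] at this
    have hne' : c a ≠ p := fun e => by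
      rw [h₁, ← e, mul_assoc, simple_mul_self, mul_one] at hp
      have : b ∈ T := ginj hp ▸ Finset.mem_insert_self b _
      exact hb this
    have e : simple (c a) * simple p = simple (c b) * simple q := by
      apply mul_left_cancel (a := g T)
      rw [← mul_assoc, ← mul_assoc, ← h₁, ← h₂, hp, hq, Finset.insert_comm]
    obtain ⟨rfl, h, -⟩ := simple_mul_simple_eq e hne hne'
    exact ⟨hq.symm, hne, h⟩
  have hstep : ∀ (S : Finset (Fin k)) a, a ∉ S → g (insert a S) = g S * simple (c a) := by
    intro S
    induction S using Finset.induction_on with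
    | empty => exact fun a _ => by simpa using (hc₂ a).symm
    | insert b T hb ih =>
      intro a ha
      simp only [Finset.mem_insert, not_or] at ha
      exact (diamond T a b ha.2 hb ha.1 (ih a ha.2) (ih b hb)).1
  have hpair : ∀ a b, a ≠ b → c a ≠ c b ∧ (c b : ℕ) ≠ c a + 1 := fun a b hab =>
    (diamond ∅ a b (by simp) (by simp) hab (hstep ∅ a (by simp)) (hstep ∅ b (by simp))).2
  have hinj : Function.Injective c := fun a b h => by
    by_contra hab
    exact (hpair a b hab).1 h
  have hnonadj : ∀ S : Finset (Fin k), NonAdj (S.image c) := by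
    intro S i hi' j hj
    obtain ⟨a, -, rfl⟩ := Finset.mem_image.1 hi'
    obtain ⟨b, -, rfl⟩ := Finset.mem_image.1 hj
    by_cases hab : a = b
    · subst hab
      omega
    · exact (hpair a b hab).2
  have hprod : ∀ S : Finset (Fin k), g S = g ∅ * swaps (S.image c) := by
    intro S
    induction S using Finset.induction_on with
    | empty => simp
    | insert a S ha ih =>
      have hna := hnonadj (insert a S)
      rw [Finset.image_insert] at hna ⊢
      rw [hstep S a ha, ih, swaps_insert hna, mul_assoc]
      simpa [hinj.eq_iff] using ha
  refine ⟨Finset.univ.image c, ?_, ⟨hnonadj _, ?_⟩, hprod _⟩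
  · rw [Finset.card_image_of_injective _ hinj, Finset.card_univ, Fintype.card_fin]
  · intro i hi'
    obtain ⟨a, -, rfl⟩ := Finset.mem_image.1 hi'
    have := hc₁ a
    rwa [← hc₂ a, IsDescent, Equiv.Perm.mul_apply, Equiv.Perm.mul_apply, simple_lo,
      simple_hi] at this

theorem IsBooleanInterval.exists_ascentSet {k : ℕ} {B : Set (WeakOrder n)}
    (h : IsBooleanInterval k B) : ∃ (π : Equiv.Perm (Fin n)) (I : Finset (Fin (n - 1))),
      I.card = k ∧ AscentSet π I ∧ B = Set.Icc (toWeak π) (toWeak (π * swaps I)) := by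
  obtain ⟨⟨σ, τ, hστ, rfl⟩, ⟨e⟩⟩ := h
  let f : Finset (Fin k) ↪o WeakOrder n :=
    e.symm.toOrderEmbedding.trans (OrderEmbedding.subtype (· ∈ Set.Icc σ τ))
  have hrange : Set.range f = Set.Icc σ τ := by
    ext x
    constructor
    · rintro ⟨S, rfl⟩
      exact (e.symm S).2
    · intro hx
      exact ⟨e ⟨x, hx⟩, by simp [f]⟩
  have hmem : ∀ S, f S ∈ Set.Icc σ τ := fun S => hrange ▸ Set.mem_range_self S
  obtain ⟨I, hk, hI, hu⟩ := exists_ascents_of_orderEmbedding f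
    (hrange ▸ Set.ordConnected_Icc) (fun S => f S) (fun _ => rfl)
  refine ⟨f ∅, I, hk, hI, ?_⟩
  rw [← hu]
  change _ = Set.Icc (f ∅) (f Finset.univ)
  obtain ⟨S, hS⟩ : σ ∈ Set.range f := hrange ▸ Set.left_mem_Icc.2 hστ
  obtain ⟨T, hT⟩ : τ ∈ Set.range f := hrange ▸ Set.right_mem_Icc.2 hστ
  rw [le_antisymm (hS ▸ f.monotone (Finset.empty_subset S)) (hmem ∅).1,
    le_antisymm (hmem Finset.univ).2 (hT ▸ f.monotone (Finset.subset_univ T))]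

/-! ### Unit Fubini rankings as permutations with nonadjacent ascents -/

theorem outcome_symm {α s : Fin n → Fin n} (hs : Parks α s) (h : IsParkingFunction α) (c : Fin n) :
    (outcome α h).symm c = s c := by
  rw [← h.choose_spec.unique hs]
  rfl

theorem outcome_eq {α : Fin n → Fin n} {π : Equiv.Perm (Fin n)} (hs : Parks α π.symm)
    (h : IsParkingFunction α) : outcome α h = π :=
  Equiv.symm_bijective.injective (Equiv.ext (outcome_symm hs h))

theorem mem_repeated {α : Fin n → Fin n} {i : Fin (n - 1)} :
    i ∈ repeated α ↔ ∃ j₁ j₂, j₁ ≠ j₂ ∧ α j₁ = lo i ∧ α j₂ = lo i := by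
  simp [repeated]

theorem IsFubiniRanking.nonAdj {α : Fin n → Fin n} (h : IsFubiniRanking α) :
    NonAdj (repeated α) := by
  intro i hi' j hj hji
  obtain ⟨j₁, -, -, h₁, -⟩ := mem_repeated.1 hj
  exact h.ne_hi hi' j₁ (h₁.trans (Fin.ext (by simpa using hji)))

theorem exists_parked_pair {α s : Fin n → Fin n} (hs : Parks α s)
    (hu : ∀ i, (s i : ℕ) = α i ∨ (s i : ℕ) = α i + 1) {i : Fin (n - 1)} (hi' : i ∈ repeated α) :
    ∃ j₁ j₂, j₁ < j₂ ∧ s j₁ = lo i ∧ s j₂ = hi i := by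
  obtain ⟨j₁, j₂, hlt, h₁, h₂⟩ : ∃ j₁ j₂, j₁ < j₂ ∧ α j₁ = lo i ∧ α j₂ = lo i := by
    obtain ⟨j₁, j₂, hne, h₁, h₂⟩ := mem_repeated.1 hi'
    rcases hne.lt_or_gt with h | h
    · exact ⟨j₁, j₂, h, h₁, h₂⟩
    · exact ⟨j₂, j₁, h, h₂, h₁⟩
  have hne : (s j₁ : ℕ) ≠ s j₂ := fun h => (hs j₂).1.2 j₁ hlt (Fin.ext h)
  -- The later car's spot was already free when the earlier car, with the same preference, arrived.
  have hle : s j₁ ≤ s j₂ :=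
    (hs j₁).2 ⟨h₁.trans h₂.symm ▸ (hs j₂).1.1, fun j hj => (hs j₂).1.2 j (hj.trans hlt)⟩
  have u₁ := hu j₁
  have u₂ := hu j₂
  rw [h₁] at u₁
  rw [h₂] at u₂
  simp only [Fin.le_def, val_lo] at hle u₁ u₂
  exact ⟨j₁, j₂, hlt, Fin.ext (by rw [val_lo]; omega), Fin.ext (by rw [val_hi]; omega)⟩

theorem card_filter_lt_of_injective {s : Fin n → Fin n} (hs : Function.Injective s) (r : Fin n) :
    (Finset.univ.filter fun j => s j < r).card = r := by
  rw [← Finset.card_map ⟨s, hs⟩, ← Fin.card_Iio r]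
  congr 1
  ext x
  simp only [Finset.mem_map, Finset.mem_filter, Finset.mem_univ, true_and,
    Function.Embedding.coeFn_mk, Finset.mem_Iio]
  constructor
  · rintro ⟨j, hj, rfl⟩
    exact hj
  · intro hx
    obtain ⟨j, rfl⟩ := Finite.surjective_of_injective hs x
    exact ⟨j, hx, rfl⟩

/-- In a unit Fubini ranking, a car that misses its preferred spot shares its preference. -/
theorem IsFubiniRanking.exists_repeated {α s : Fin n → Fin n} (h : IsFubiniRanking α)
    (hs : Parks α s) (hu : ∀ i, (s i : ℕ) = α i ∨ (s i : ℕ) = α i + 1) {c : Fin n}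
    (hc : s c ≠ α c) : ∃ i ∈ repeated α, α c = lo i ∧ s c = hi i := by
  have hsc : (s c : ℕ) = α c + 1 := (hu c).resolve_left fun e => hc (Fin.ext e)
  obtain ⟨d, hdc, hd⟩ : ∃ d < c, s d = α c := by
    by_contra! hno
    have : s c ≤ α c := (hs c).2 ⟨le_rfl, hno⟩
    rw [Fin.le_def] at this
    omega
  -- Otherwise d and all cars parked before spot `α c` rank strictly better than c, one more than
  -- the Fubini condition allows.
  have hα : α d = α c := by
    by_contra hne
    have hlt : α d < α c := lt_of_le_of_ne (hd ▸ (hs d).1.1) hne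
    have hsub : insert d (Finset.univ.filter fun j => s j < α c) ⊆
        Finset.univ.filter fun j => α j < α c := by
      intro x hx
      simp only [Finset.mem_insert, Finset.mem_filter, Finset.mem_univ, true_and] at hx ⊢
      rcases hx with rfl | hx
      · exact hlt
      · exact (hs x).1.1.trans_lt hx
    have hcard := Finset.card_le_card hsub
    rw [Finset.card_insert_of_notMem (by simp [hd]), card_filter_lt_of_injective hs.injective,
      ← h c] at hcard
    omega
  have hlt : (α c : ℕ) < n - 1 := by
    have := (s c).2
    omega
  exact ⟨⟨α c, hlt⟩, mem_repeated.2 ⟨d, c, hdc.ne, hα, rfl⟩, rfl, Fin.ext hsc⟩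

theorem UFR.exists_parks (α : UFR n) : Parks α.1 α.outcome.symm ∧
    ∀ i, (α.outcome.symm i : ℕ) = α.1 i ∨ (α.outcome.symm i : ℕ) = α.1 i + 1 := by
  obtain ⟨s, hs, hu⟩ := α.2.2
  have e : ⇑α.outcome.symm = s := funext fun c => outcome_symm hs _ c
  rw [e]
  exact ⟨hs, hu⟩

theorem UFR.ascentSet (α : UFR n) : AscentSet α.outcome (repeated α.1) := by
  refine ⟨α.2.1.nonAdj, fun i hi' => ?_⟩
  obtain ⟨hs, hu⟩ := α.exists_parks
  obtain ⟨j₁, j₂, hlt, h₁, h₂⟩ := exists_parked_pair hs hu hi'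
  rwa [← h₁, ← h₂, Equiv.apply_symm_apply, Equiv.apply_symm_apply]

theorem UFR.prodSimple_eq (α : UFR n) : α.prodSimple = swaps (repeated α.1) := by
  rw [swaps, dif_pos α.2.1.nonAdj]
  rfl

theorem UFR.interval_eq (α : UFR n) :
    α.interval = Set.Icc (toWeak α.outcome) (toWeak (α.outcome * swaps (repeated α.1))) := by
  rw [UFR.interval, α.prodSimple_eq]

/-- The ranking with outcome `π` in which the cars in the spots `i` and `i + 1` tie at rank `i`,
for all `i ∈ I`. -/
noncomputable def ranking (π : Equiv.Perm (Fin n)) (I : Finset (Fin (n - 1))) (c : Fin n) : Fin n :=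
  min (swaps I (π.symm c)) (π.symm c)

theorem ranking_cases {π : Equiv.Perm (Fin n)} {I : Finset (Fin (n - 1))} (hI : NonAdj I)
    (c : Fin n) : (ranking π I c = π.symm c ∧ ∀ i ∈ I, π.symm c ≠ hi i) ∨
      ∃ i ∈ I, ranking π I c = lo i ∧ π.symm c = hi i := by
  unfold ranking
  rcases swaps_cases hI (π.symm c) with ⟨h, e⟩ | ⟨i, hi', h, e⟩ | ⟨i, hi', h, e⟩ <;> rw [e]
  · exact Or.inl ⟨min_self _, fun i hi' => (h i hi').2⟩
  · refine Or.inl ⟨min_eq_right (h ▸ (lo_lt_hi i).le), fun j hj hji => hI j hj i hi' ?_⟩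
    simpa [Fin.ext_iff] using h.symm.trans hji
  · exact Or.inr ⟨i, hi', min_eq_left (h ▸ (lo_lt_hi i).le), h⟩

theorem ranking_ne_hi {π : Equiv.Perm (Fin n)} {I : Finset (Fin (n - 1))} (hI : NonAdj I)
    (c : Fin n) {i : Fin (n - 1)} (hi' : i ∈ I) : ranking π I c ≠ hi i := by
  rcases ranking_cases (π := π) hI c with ⟨e, h⟩ | ⟨j, hj, e, -⟩ <;> rw [e]
  · exact h i hi'
  · intro h
    exact hI i hi' j hj (by simpa [Fin.ext_iff] using h)

/-- A unit Fubini ranking is determined by its outcome and its repeated values. -/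
theorem UFR.eq_ranking (α : UFR n) : α.1 = ranking α.outcome (repeated α.1) := by
  obtain ⟨hs, hu⟩ := α.exists_parks
  funext c
  rcases ranking_cases (π := α.outcome) α.2.1.nonAdj c with ⟨e, h⟩ | ⟨i, hi', e, h⟩ <;> rw [e]
  · by_contra hne
    obtain ⟨i, hi', -, h'⟩ := α.2.1.exists_repeated hs hu (Ne.symm hne)
    exact h i hi' h'
  · obtain ⟨j, -, h₁, h₂⟩ := α.2.1.exists_repeated hs hu (c := c)
      fun e' => α.2.1.ne_hi hi' c (e'.symm.trans h)
    rw [h₁, hi_inj.1 (h₂.symm.trans h)]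

/-- A car lowered to preference i finds spot i taken: as i is an ascent, the car there arrived
earlier. -/
theorem AscentSet.parks_ranking {π : Equiv.Perm (Fin n)} {I : Finset (Fin (n - 1))}
    (h : AscentSet π I) : Parks (ranking π I) π.symm := by
  intro c
  refine ⟨⟨min_le_right _ _, fun j hj e => hj.ne (π.symm.injective e)⟩, fun t ht => ?_⟩
  rcases ranking_cases (π := π) h.nonAdj c with ⟨e, -⟩ | ⟨i, hi', e, hc⟩
  · exact e ▸ ht.1
  · have hlt : π (lo i) < c := by
      have := h.ascent i hi'
      rwa [← hc, Equiv.apply_symm_apply] at this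
    have h₁ := ht.1
    have h₂ := ht.2 _ hlt
    rw [Equiv.symm_apply_apply] at h₂
    rw [e] at h₁
    rw [hc]
    simp only [Fin.le_def, ne_eq, Fin.ext_iff, val_lo, val_hi] at h₁ h₂ ⊢
    omega

theorem AscentSet.isUnitIntervalParkingFunction {π : Equiv.Perm (Fin n)}
    {I : Finset (Fin (n - 1))} (h : AscentSet π I) :
    IsUnitIntervalParkingFunction (ranking π I) := by
  refine ⟨π.symm, h.parks_ranking, fun c => ?_⟩
  rcases ranking_cases (π := π) h.nonAdj c with ⟨e, -⟩ | ⟨i, -, e, hc⟩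
  · exact Or.inl (by rw [e])
  · exact Or.inr (by rw [e, hc, val_lo, val_hi])

/-- Lowering a preference from i + 1 to i never crosses an occurring rank, since i + 1 is not one;
so counting better ranks amounts to counting earlier spots. -/
theorem isFubiniRanking_ranking {π : Equiv.Perm (Fin n)} {I : Finset (Fin (n - 1))}
    (hI : NonAdj I) : IsFubiniRanking (ranking π I) := by
  intro c
  rw [← card_filter_lt_of_injective π.symm.injective (ranking π I c)]
  congr 1
  ext j
  simp only [Finset.mem_filter, Finset.mem_univ, true_and]
  rcases ranking_cases (π := π) hI j with ⟨e, -⟩ | ⟨i, hi', e, hj⟩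
  · rw [e]
  · have := ranking_ne_hi (π := π) hI c hi'
    rw [e, hj]
    simp only [Fin.lt_def, ne_eq, Fin.ext_iff, val_lo, val_hi] at this ⊢
    omega

theorem repeated_ranking {π : Equiv.Perm (Fin n)} {I : Finset (Fin (n - 1))} (hI : NonAdj I) :
    repeated (ranking π I) = I := by
  ext i
  constructor
  · intro hi'
    have hne := (isFubiniRanking_ranking hI).ne_hi hi' (π (hi i))
    rcases ranking_cases (π := π) hI (π (hi i)) with ⟨e, -⟩ | ⟨j, hj, -, h⟩
    · rw [e, Equiv.symm_apply_apply] at hne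
      exact absurd rfl hne
    · rw [Equiv.symm_apply_apply, hi_inj] at h
      rwa [h]
  · intro hi'
    refine mem_repeated.2 ⟨π (lo i), π (hi i), fun e => (lo_lt_hi i).ne (π.injective e), ?_, ?_⟩
    · rw [ranking, Equiv.symm_apply_apply, swaps_lo hI hi', min_eq_right (lo_lt_hi i).le]
    · rw [ranking, Equiv.symm_apply_apply, swaps_hi hI hi', min_eq_left (lo_lt_hi i).le]

theorem AscentSet.exists_ufr {π : Equiv.Perm (Fin n)} {I : Finset (Fin (n - 1))}
    (h : AscentSet π I) : ∃ α : UFR n, α.outcome = π ∧ repeated α.1 = I :=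
  ⟨⟨ranking π I, isFubiniRanking_ranking h.nonAdj, h.isUnitIntervalParkingFunction⟩,
    outcome_eq h.parks_ranking _, repeated_ranking h.nonAdj⟩

/-- Each repeated value i costs exactly one rank, namely i + 1. -/
theorem UFR.numRanks_add_card (α : UFR n) : numRanks α.1 + (repeated α.1).card = n := by
  have himage : Finset.univ.image α.1 = ((repeated α.1).image hi)ᶜ := by
    ext r
    simp only [Finset.mem_image, Finset.mem_univ, true_and, Finset.mem_compl, not_exists, not_and]
    constructor
    · rintro ⟨c, rfl⟩ i hi' e
      exact α.2.1.ne_hi hi' c e.symm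
    · intro hr
      refine ⟨α.outcome r, ?_⟩
      rcases ranking_cases (π := α.outcome) α.2.1.nonAdj (α.outcome r) with
        ⟨e, -⟩ | ⟨i, hi', -, h⟩
      · rw [congrFun α.eq_ranking, e, Equiv.symm_apply_apply]
      · rw [Equiv.symm_apply_apply] at h
        exact absurd h.symm (hr i hi')
  rw [numRanks, himage, ← Finset.card_image_of_injective (repeated α.1) fun _ _ => hi_inj.1,
    Finset.card_compl_add_card, Fintype.card_fin]

theorem UFR.interval_injective : Function.Injective (UFR.interval (n := n)) := by
  intro α β h
  rw [α.interval_eq, β.interval_eq, Set.Icc_eq_Icc_iff α.ascentSet.le_swaps] at h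
  have hπ : α.outcome = β.outcome := h.1
  have hswaps : swaps (repeated α.1) = swaps (repeated β.1) := by
    have h₂ : α.outcome * swaps (repeated α.1) = β.outcome * swaps (repeated β.1) := h.2
    rw [hπ] at h₂
    exact mul_left_cancel h₂
  have hI : repeated α.1 = repeated β.1 := by
    ext i
    rw [mem_iff_swaps_hi_lt α.2.1.nonAdj, mem_iff_swaps_hi_lt β.2.1.nonAdj, hswaps]
  apply Subtype.ext
  rw [α.eq_ranking, β.eq_ranking, hπ, hI]

end UnitFubini

/-- The rank condition is additive to avoid truncated subtraction; for k > n both sets are empty. -/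
theorem mainTheorem1 (n k : ℕ) :
    Set.BijOn (UnitFubini.UFR.interval (n := n))
      {α : UnitFubini.UFR n | UnitFubini.numRanks α.1 + k = n}
      {B : Set (UnitFubini.WeakOrder n) | UnitFubini.IsBooleanInterval k B} := by
  refine ⟨fun α hα => ?_, UnitFubini.UFR.interval_injective.injOn, fun B hB => ?_⟩
  · have hα' : UnitFubini.numRanks α.1 + k = n := hα
    have hk : k = (UnitFubini.repeated α.1).card := by
      have := α.numRanks_add_card
      omega
    rw [Set.mem_ofPred_eq, α.interval_eq, hk]
    exact α.ascentSet.isBooleanInterval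
  · obtain ⟨π, I, hk, hI, rfl⟩ := UnitFubini.IsBooleanInterval.exists_ascentSet hB
    obtain ⟨α, hπ, hα⟩ := hI.exists_ufr
    refine ⟨α, ?_, ?_⟩
    · have := α.numRanks_add_card
      rwa [hα, hk] at this
    · rw [α.interval_eq, hπ, hα]
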